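/- Let $k$ be a commutative ring, let $G$ be a finite group with neutral element $e$, and let $k^G$ be the Hopf algebra of functions $G\to k$: with $\delta_g$ ($g\in G$) the indicator functions, the product is pointwise, $\Delta(\delta_g)=\sum_{ab=g}\delta_a\otimes\delta_b$, the counit is $f\mapsto f(e)$, and the antipode sends $\delta_g$ to $\delta_{g^{-1}}$. Let $E$ be a right $k^G$-comodule algebra, i.e. an associative unital $k$-algebra with a right comodule structure $\Delta_E:E\to E\otimes_k k^G$ that is a morphism of algebras. *Hopf torsors.* For an algebra $D$ and a right $D$-module $M$, let $M^\times$ be the set of those $u\in M$ for which the map $D\to M$, $x\mapsto ux$, is bijective; for $M=D$ this is the group of units. A $(k^G,E)$-Hopf module is a right $E$-module $T$ with a right comodule structure $\Delta_T:T\to T\otimes_k k^G$ such that $\Delta_T(ux)=\Delta_T(u)\Delta_E(x)$ for all $u\in T$, $x\in E$; an isomorphism of Hopf modules is an $E$-linear bijection that commutes with the coactions. A $(k^G,E)$-Hopf torsor is a Hopf module $T$ that contains some $u\in T^\times$ with $\Delta_T(u)\in(T\otimes_k k^G)^\times$, where $T\otimes_k k^G$ is regarded as a right $E\otimes_k k^G$-module.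 Let $\mathcal{T}\mathrm{ors}(k^G,E)$ be the set of isomorphism classes of $(k^G,E)$-Hopf torsors, pointed by the class of $(E,\Delta_E)$. *Group torsors.* For a $G$-group $A$ (a group on which $G$ acts on the left by automorphisms), a $(G,A)$-group torsor is a non-empty left $G$-set $P$ with a simply transitive right action of $A$ such that ${}^g(pa)=({}^gp)({}^ga)$ for all $g\in G$, $p\in P$, $a\in A$; an isomorphism of group torsors is a bijection that commutes with both actions. Let $\mathrm{Tors}(G,A)$ be the set of isomorphism classes $[P]$ of $(G,A)$-group torsors, pointed by the class of $A$ with its right translations. The formula $\Delta_E(x)=\sum_{g\in G}{}^gx\otimes\delta_g$ makes $E^\times$ a $G$-group. If $T$ is a $(k^G,E)$-Hopf torsor, then the action of $G$ given by $\Delta_T(u)=\sum_{g\in G}{}^gu\otimes\delta_g$ and the right action of $E^\times$ make $T^\times$ a $(G,E^\times)$-group torsor. **Corollary 3.8.** The map $T\mapsto[T^\times]$ is constant on isomorphism classes of Hopf torsors, and the induced map $\mathcal{T}\mathrm{ors}(k^G,E)\to\mathrm{Tors}(G,E^\times)$ is a bijection of pointed sets. -/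

import Mathlib

open scoped TensorProduct
open MulOpposite (op)

universe u v w

/-! ### The Hopf algebra of functions on a finite group -/

/-- The `k`-algebra `k^G` of functions on `G`, with pointwise operations. It is a copy of `G → k`,
because `G → k` carries another coalgebra structure in Mathlib. -/
def FunHopf (k : Type u) (G : Type v) : Type (max u v) := G → k

namespace FunHopf

section Algebra

variable {k : Type u} [CommRing k] {G : Type v}

instance instCommRing : CommRing (FunHopf k G) := inferInstanceAs (CommRing (G → k))

instance instAlgebra : Algebra k (FunHopf k G) := inferInstanceAs (Algebra k (G → k))

/-- Evaluation at `g`, as a morphism of algebras. -/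
def ev (g : G) : FunHopf k G →ₐ[k] k := Pi.evalAlgHom k (fun _ : G => k) g

theorem ev_ext {f f' : FunHopf k G} (h : ∀ g, ev g f = ev g f') : f = f' := funext h

/-- The coordinate of index `g` of an element of `M ⊗ k^G`: the image under
`id ⊗ ev g : M ⊗ k^G → M ⊗ k = M`. -/
def coord {M : Type w} [AddCommGroup M] [Module k M] (g : G) : M ⊗[k] FunHopf k G →ₗ[k] M :=
  (TensorProduct.rid k M).toLinearMap ∘ₗ LinearMap.lTensor M (ev g).toLinearMap

@[simp] theorem coord_tmul {M : Type w} [AddCommGroup M] [Module k M] (g : G) (m : M)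
    (f : FunHopf k G) : coord g (m ⊗ₜ[k] f) = ev g f • m := by
  simp [coord]

theorem coord_rTensor {M N : Type*} [AddCommGroup M] [Module k M] [AddCommGroup N] [Module k N]
    (F : M →ₗ[k] N) (g : G) (z : M ⊗[k] FunHopf k G) :
    coord g (LinearMap.rTensor (FunHopf k G) F z) = F (coord g z) := by
  induction z with
  | zero => simp
  | add x y hx hy => simp [hx, hy]
  | tmul m f => simp

/-- `ev a ⊗ ev b`, as a morphism of algebras `k^G ⊗ k^G → k`. -/
def ev₂ (a b : G) : FunHopf k G ⊗[k] FunHopf k G →ₐ[k] k :=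
  Algebra.TensorProduct.lift (ev a) (ev b) fun _ _ => Commute.all _ _

@[simp] theorem ev₂_tmul (a b : G) (f f' : FunHopf k G) :
    ev₂ a b (f ⊗ₜ[k] f') = ev a f * ev b f' := by
  simp [ev₂]

theorem ev_coord (a b : G) (z : FunHopf k G ⊗[k] FunHopf k G) :
    ev a (coord b z) = ev₂ a b z := by
  induction z with
  | zero => simp
  | add x y hx hy => simp only [map_add, hx, hy]
  | tmul m f => simp [mul_comm]

theorem ev₂_coord_assoc_symm (a b c : G) (f : FunHopf k G)
    (z : FunHopf k G ⊗[k] FunHopf k G) :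
    ev₂ a b (coord c ((TensorProduct.assoc k _ _ _).symm (f ⊗ₜ[k] z))) =
      ev a f * ev₂ b c z := by
  induction z with
  | zero => simp
  | add x y hx hy => simp only [TensorProduct.tmul_add, map_add, hx, hy, mul_add]
  | tmul m f => simp; ring

end Algebra

section Basis

variable {k : Type u} [CommRing k] {G : Type v} [DecidableEq G]

variable (k) in
/-- The basis element `δ_g`. -/
def delta (g : G) : FunHopf k G := (Pi.single g (1 : k) : G → k)

@[simp] theorem ev_delta (g h : G) : ev g (delta k h) = if g = h then 1 else 0 :=
  Pi.single_apply h (1 : k) g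

variable [Fintype G]

theorem sum_delta (f : FunHopf k G) : f = ∑ g, ev g f • delta k g := by
  refine ev_ext fun h => ?_
  simp [map_sum]

/-- Every element of `M ⊗ k^G` is the sum of the `m_g ⊗ δ_g`, where the `m_g` are its
coordinates. -/
theorem tensor_expand {M : Type w} [AddCommGroup M] [Module k M] (z : M ⊗[k] FunHopf k G) :
    z = ∑ g, coord g z ⊗ₜ[k] delta k g := by
  induction z with
  | zero => simp
  | add x y hx hy =>
    conv_lhs => rw [hx, hy]
    simp [TensorProduct.add_tmul, Finset.sum_add_distrib]
  | tmul m f =>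
    conv_lhs => rw [sum_delta f]
    simp [TensorProduct.tmul_sum, TensorProduct.smul_tmul]

theorem tensor_ext {M : Type w} [AddCommGroup M] [Module k M] {y z : M ⊗[k] FunHopf k G}
    (h : ∀ g, coord g y = coord g z) : y = z := by
  rw [tensor_expand y, tensor_expand z]
  simp only [h]

theorem tensor_ext₂ {y z : FunHopf k G ⊗[k] FunHopf k G}
    (h : ∀ a b, ev₂ a b y = ev₂ a b z) : y = z :=
  tensor_ext fun b => ev_ext fun a => by rw [ev_coord, ev_coord, h]

end Basis

section Hopf

set_option linter.unusedSectionVars false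

variable (k : Type u) [CommRing k] (G : Type v) [DecidableEq G] [Fintype G] [Group G]

/-- The comultiplication of `k^G`: `Δ f = ∑_{a, b} f (a b) δ_a ⊗ δ_b`; on the basis,
`Δ δ_g = ∑_{a b = g} δ_a ⊗ δ_b`. -/
def comulMap : FunHopf k G →ₗ[k] FunHopf k G ⊗[k] FunHopf k G :=
  ∑ a : G, ∑ b : G, (ev (a * b)).toLinearMap.smulRight (delta k a ⊗ₜ[k] delta k b)

/-- The antipode of `k^G`: `(σ f) g = f g⁻¹`; on the basis, `σ δ_g = δ_{g⁻¹}`. -/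
def antipodeMap : FunHopf k G →ₗ[k] FunHopf k G :=
  LinearMap.pi (φ := fun _ : G => k) fun g => (ev g⁻¹).toLinearMap

variable {k G}

theorem comulMap_delta (g : G) : comulMap k G (delta k g) =
    ∑ p : G × G with p.1 * p.2 = g, delta k p.1 ⊗ₜ[k] delta k p.2 := by
  simp [comulMap, Finset.sum_filter, Fintype.sum_prod_type]

theorem ev_antipodeMap (g : G) (f : FunHopf k G) : ev g (antipodeMap k G f) = ev g⁻¹ f := rfl

theorem antipodeMap_delta (g : G) : antipodeMap k G (delta k g) = delta k g⁻¹ :=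
  ev_ext fun h => by simp [ev_antipodeMap, inv_eq_iff_eq_inv]

@[simp] theorem ev₂_comulMap (a b : G) (f : FunHopf k G) :
    ev₂ a b (comulMap k G f) = ev (a * b) f := by
  simp only [comulMap, LinearMap.sum_apply, LinearMap.smulRight_apply, map_sum, map_smul, ev₂_tmul,
    ev_delta]
  rw [Finset.sum_eq_single a, Finset.sum_eq_single b] <;> simp +contextual [eq_comm]

theorem ev₂_coord_lTensor (a b c : G) (z : FunHopf k G ⊗[k] FunHopf k G) :
    ev₂ a b (coord c ((TensorProduct.assoc k _ _ _).symm
      (LinearMap.lTensor (FunHopf k G) (comulMap k G) z))) = ev₂ a (b * c) z := by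
  induction z with
  | zero => simp
  | add x y hx hy => simp only [map_add, hx, hy]
  | tmul f f' => rw [LinearMap.lTensor_tmul, ev₂_coord_assoc_symm, ev₂_comulMap, ev₂_tmul]

variable (k G)

instance instCoalgebra : Coalgebra k (FunHopf k G) where
  comul := comulMap k G
  counit := (ev (1 : G)).toLinearMap
  coassoc := by
    refine LinearMap.ext fun f => ?_
    simp only [LinearMap.comp_apply, LinearEquiv.coe_coe]
    rw [← LinearEquiv.eq_symm_apply]
    refine tensor_ext fun c => tensor_ext₂ fun a b => ?_
    rw [coord_rTensor, ev₂_comulMap, ev_coord, ev₂_coord_lTensor, ev₂_comulMap, ev₂_comulMap,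
      mul_assoc]
  rTensor_counit_comp_comul := by
    refine LinearMap.ext fun f => tensor_ext fun c => ?_
    simp only [LinearMap.comp_apply]
    rw [coord_rTensor]
    simp [ev_coord]
  lTensor_counit_comp_comul := by
    refine LinearMap.ext fun f => (TensorProduct.rid k _).injective (ev_ext fun a => ?_)
    simp only [LinearMap.comp_apply]
    change ev a (coord 1 (comulMap k G f)) = _
    simp [ev_coord]

instance instBialgebra : Bialgebra k (FunHopf k G) :=
  Bialgebra.mk' k (FunHopf k G)
    (map_one (ev (1 : G))) (fun {a b} => map_mul (ev (1 : G)) a b)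
    (tensor_ext₂ fun a b => by
      change ev₂ a b (comulMap k G 1) = _
      simp)
    (fun {f f'} => tensor_ext₂ fun a b => by
      change ev₂ a b (comulMap k G (f * f')) =
        ev₂ a b (comulMap k G f * comulMap k G f')
      simp)

theorem ev_mul'_rTensor (g : G) (z : FunHopf k G ⊗[k] FunHopf k G) :
    ev g (LinearMap.mul' k _ (LinearMap.rTensor _ (antipodeMap k G) z)) = ev₂ g⁻¹ g z := by
  induction z with
  | zero => simp
  | add x y hx hy => simp only [map_add, hx, hy]
  | tmul f f' => simp [ev_antipodeMap]

theorem ev_mul'_lTensor (g : G) (z : FunHopf k G ⊗[k] FunHopf k G) :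
    ev g (LinearMap.mul' k _ (LinearMap.lTensor _ (antipodeMap k G) z)) = ev₂ g g⁻¹ z := by
  induction z with
  | zero => simp
  | add x y hx hy => simp only [map_add, hx, hy]
  | tmul f f' => simp [ev_antipodeMap]

instance instHopfAlgebra : HopfAlgebra k (FunHopf k G) where
  antipode := antipodeMap k G
  mul_antipode_rTensor_comul := LinearMap.ext fun f => ev_ext fun g => by
    change ev g (LinearMap.mul' k _ (LinearMap.rTensor _ (antipodeMap k G) (comulMap k G f))) =
      ev g (algebraMap k _ (ev 1 f))
    rw [ev_mul'_rTensor, ev₂_comulMap, AlgHom.commutes, inv_mul_cancel]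
    rfl
  mul_antipode_lTensor_comul := LinearMap.ext fun f => ev_ext fun g => by
    change ev g (LinearMap.mul' k _ (LinearMap.lTensor _ (antipodeMap k G) (comulMap k G f))) =
      ev g (algebraMap k _ (ev 1 f))
    rw [ev_mul'_lTensor, ev₂_comulMap, AlgHom.commutes, mul_inv_cancel]
    rfl

end Hopf

end FunHopf

/-! ### Comodules, comodule algebras, Hopf modules -/

/-- A right comodule `M` over the coalgebra `H`. -/
class RightComodule (k : Type*) (H : Type*) (M : Type*) [CommRing k] [AddCommGroup H]
    [Module k H] [Coalgebra k H] [AddCommGroup M] [Module k M] where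
  /-- The coaction `Δ_M`. -/
  coact : M →ₗ[k] M ⊗[k] H
  /-- `(Δ_M ⊗ id) ∘ Δ_M = (id ⊗ Δ_H) ∘ Δ_M`. -/
  coact_coassoc : (TensorProduct.assoc k M H H).toLinearMap ∘ₗ LinearMap.rTensor H coact ∘ₗ coact =
    LinearMap.lTensor M (Coalgebra.comul (R := k) (A := H)) ∘ₗ coact
  /-- `(id ⊗ ε_H) ∘ Δ_M = id`. -/
  coact_counit : (TensorProduct.rid k M).toLinearMap ∘ₗ
    LinearMap.lTensor M (Coalgebra.counit (R := k) (A := H)) ∘ₗ coact = LinearMap.id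

/-- An `H`-comodule algebra `E`: the coaction is a morphism of algebras. -/
class ComoduleAlgebra (k : Type*) (H : Type*) (E : Type*) [CommRing k] [Ring H]
    [HopfAlgebra k H] [Ring E] [Algebra k E] extends RightComodule k H E where
  coact_one : coact 1 = 1
  coact_mul : ∀ x y : E, coact (x * y) = coact x * coact y

section RightModules

variable (k : Type*) (H : Type*) (E : Type*) (T : Type*) [CommRing k] [Ring H] [HopfAlgebra k H]
  [Ring E] [Algebra k E] [AddCommGroup T] [Module k T] [Module Eᵐᵒᵖ T] [IsScalarTower k Eᵐᵒᵖ T]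

/-- The right action of `E` on the right `E`-module `T`, as a `k`-bilinear map `(u, x) ↦ u x`.
As usual in Mathlib, a right `E`-module is a left module over `Eᵐᵒᵖ`, and `u x` is `op x • u`. -/
def rightAct : T →ₗ[k] E →ₗ[k] T :=
  LinearMap.mk₂ k (fun u x => op x • u) (fun _ _ _ => smul_add _ _ _)
    (fun c u x => smul_comm (op x) c u) (fun _ _ _ => add_smul _ _ _)
    (fun c u x => smul_assoc c (op x) u)

/-- The right action of `E ⊗ H` on `T ⊗ H`, as a `k`-bilinear map; on pure tensors,
`(u ⊗ a) (x ⊗ b) = u x ⊗ a b`. -/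
def tensorRightAct : T ⊗[k] H →ₗ[k] E ⊗[k] H →ₗ[k] T ⊗[k] H :=
  TensorProduct.map₂ (rightAct k E T) (LinearMap.mul k H)

/-- The set `T^×` of those `u` in the right `E`-module `T` for which `ϑ_u : E → T`, `x ↦ u x`, is
bijective. -/
def invElems (E : Type*) (T : Type*) [Ring E] [AddCommGroup T] [Module Eᵐᵒᵖ T] : Set T :=
  {u | Function.Bijective fun x : E => op x • u}

/-- The set `(T ⊗ H)^×` for the right `E ⊗ H`-module `T ⊗ H`. -/
def tensorInvElems : Set (T ⊗[k] H) :=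
  {z | Function.Bijective fun X : E ⊗[k] H => tensorRightAct k H E T z X}

/-- An `(H, E)`-Hopf module `T`: a right `E`-module and a right `H`-comodule whose coaction is
`(H, E)`-linear. -/
class HopfModule [ComoduleAlgebra k H E] extends RightComodule k H T where
  coact_smul : ∀ (u : T) (x : E), coact (op x • u) =
    tensorRightAct k H E T (coact u) (RightComodule.coact x)

/-- The set `T^•` of those `u` in `T^×` for which `Δ_T u` belongs to `(T ⊗ H)^×`. -/
def bulletElems [ComoduleAlgebra k H E] [HopfModule k H E T] : Set T :=
  {u | u ∈ invElems E T ∧ RightComodule.coact u ∈ tensorInvElems k H E T}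

end RightModules

/-! ### Hopf torsors -/

section HopfTorsors

variable (k : Type*) (H : Type*) (E : Type w) [CommRing k] [Ring H] [HopfAlgebra k H]
  [Ring E] [Algebra k E] [ComoduleAlgebra k H E]

/-- An `(H, E)`-Hopf torsor. The underlying set is taken in the universe of `E`; nothing is lost,
since it is in bijection with `E`. -/
structure HopfTorsor where
  /-- The underlying set. -/
  carrier : Type w
  [addCommGroup : AddCommGroup carrier]
  [module : Module k carrier]
  [rightModule : Module Eᵐᵒᵖ carrier]
  [isScalarTower : IsScalarTower k Eᵐᵒᵖ carrier]
  [hopfModule : HopfModule k H E carrier]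
  nonempty_bullet : (bulletElems k H E carrier).Nonempty

attribute [instance] HopfTorsor.addCommGroup HopfTorsor.module HopfTorsor.rightModule
  HopfTorsor.isScalarTower HopfTorsor.hopfModule

namespace HopfTorsor

variable {k H E}

/-- The `E`-linear bijection `f` is an isomorphism of `(H, E)`-Hopf modules:
`(f ⊗ id) ∘ Δ = Δ' ∘ f`. -/
def IsHopfIso (T T' : HopfTorsor k H E) (f : T.carrier ≃ₗ[Eᵐᵒᵖ] T'.carrier) : Prop :=
  ∀ u : T.carrier, LinearMap.rTensor H (f.toLinearMap.restrictScalars k)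
    (RightComodule.coact u) = RightComodule.coact (f u)

variable (k H E) in
/-- Two Hopf torsors are equivalent if they are isomorphic as Hopf modules. -/
instance instSetoid : Setoid (HopfTorsor k H E) where
  r T T' := ∃ f : T.carrier ≃ₗ[Eᵐᵒᵖ] T'.carrier, IsHopfIso T T' f
  iseqv :=
    { refl := fun T => ⟨LinearEquiv.refl _ _, fun u => by
        change LinearMap.rTensor H LinearMap.id _ = _
        simp⟩
      symm := by
        rintro T T' ⟨f, hf⟩
        refine ⟨f.symm, fun u => ?_⟩
        obtain ⟨v, rfl⟩ := f.surjective u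
        rw [← hf, ← LinearMap.comp_apply, ← LinearMap.rTensor_comp, f.symm_apply_apply]
        have h : f.symm.toLinearMap.restrictScalars k ∘ₗ f.toLinearMap.restrictScalars k =
            LinearMap.id := LinearMap.ext fun x => f.symm_apply_apply x
        rw [h, LinearMap.rTensor_id, LinearMap.id_apply]
      trans := by
        rintro T T' T'' ⟨f, hf⟩ ⟨f', hf'⟩
        refine ⟨f.trans f', fun u => ?_⟩
        rw [LinearEquiv.trans_apply, ← hf', ← hf]
        exact LinearMap.rTensor_comp_apply H (f'.toLinearMap.restrictScalars k)
          (f.toLinearMap.restrictScalars k) _ }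

variable (k H E)

/-- The algebra `E` as an `(H, E)`-Hopf module. -/
instance instHopfModuleSelf : HopfModule k H E E where
  coact_smul u x := by
    change RightComodule.coact (u * x) = _
    rw [ComoduleAlgebra.coact_mul]
    generalize (RightComodule.coact u : E ⊗[k] H) = y
    generalize (RightComodule.coact x : E ⊗[k] H) = z
    induction y with
    | zero => simp
    | add y y' hy hy' => simp only [add_mul, map_add, LinearMap.add_apply, hy, hy']
    | tmul e a =>
      induction z with
      | zero => simp
      | add y y' hy hy' => simp only [mul_add, map_add, hy, hy']
      | tmul e' a' => simp [tensorRightAct, rightAct]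

/-- The Hopf torsor `(E, Δ_E)`. -/
def self : HopfTorsor k H E where
  carrier := E
  nonempty_bullet := by
    refine ⟨1, ?_, ?_⟩
    · change Function.Bijective fun x : E => 1 * x
      simp only [one_mul]
      exact Function.bijective_id
    · change Function.Bijective fun X : E ⊗[k] H => tensorRightAct k H E E (RightComodule.coact 1) X
      rw [ComoduleAlgebra.coact_one]
      convert Function.bijective_id with X
      induction X with
      | zero => simp
      | add y y' hy hy' => simp only [map_add, hy, hy', id]
      | tmul e a => simp [tensorRightAct, rightAct, Algebra.TensorProduct.one_def]

end HopfTorsor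

/-- The set of equivalence classes of `(H, E)`-Hopf torsors. -/
abbrev HopfTorsorClasses := Quotient (HopfTorsor.instSetoid k H E)

end HopfTorsors

/-! ### Group torsors -/

section GroupTorsors

variable (G : Type*) [Group G] (A : Type w) [Group A] [MulDistribMulAction G A]

/-- A `(G, A)`-group torsor, for a `G`-group `A`: a non-empty left `G`-set on which `A` acts on the
right, compatibly with the actions of `G`, and simply transitively. The underlying set is taken in
the universe of `A`; nothing is lost, since it is in bijection with `A`. -/
structure GroupTorsor where
  /-- The underlying set. -/
  carrier : Type w
  [leftAction : MulAction G carrier]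
  [rightAction : MulAction Aᵐᵒᵖ carrier]
  nonempty : Nonempty carrier
  smul_op_smul : ∀ (g : G) (a : A) (p : carrier), g • (op a • p) = op (g • a) • (g • p)
  bijective_op_smul : ∀ p : carrier, Function.Bijective fun a : A => op a • p

attribute [instance] GroupTorsor.leftAction GroupTorsor.rightAction

namespace GroupTorsor

/-- Isomorphism of group torsors: a bijection compatible with both actions. -/
instance instSetoid : Setoid (GroupTorsor G A) where
  r P Q := ∃ f : P.carrier ≃ Q.carrier,
    (∀ (g : G) (p : P.carrier), f (g • p) = g • f p) ∧
    (∀ (a : A) (p : P.carrier), f (op a • p) = op a • f p)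
  iseqv :=
    { refl := fun P => ⟨Equiv.refl _, fun _ _ => rfl, fun _ _ => rfl⟩
      symm := by
        rintro P Q ⟨f, h, h'⟩
        exact ⟨f.symm, fun g q => by rw [f.symm_apply_eq, h, f.apply_symm_apply],
          fun a q => by rw [f.symm_apply_eq, h', f.apply_symm_apply]⟩
      trans := by
        rintro P Q R ⟨f, h, h'⟩ ⟨e, i, i'⟩
        exact ⟨f.trans e, fun g p => by simp [h, i], fun a p => by simp [h', i']⟩ }

/-- The trivial group torsor: `A` itself, with the right translations. -/
def self : GroupTorsor G A where
  carrier := A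
  nonempty := ⟨1⟩
  smul_op_smul g a p := smul_mul' g p a
  bijective_op_smul p := (Equiv.mulLeft p).bijective

end GroupTorsor

/-- The set of isomorphism classes of `(G, A)`-group torsors. -/
abbrev GroupTorsorClasses := Quotient (GroupTorsor.instSetoid G A)

end GroupTorsors

/-! ### From Hopf torsors over `k^G` to group torsors -/

section Comparison

variable (k : Type*) [CommRing k] {G : Type*} [DecidableEq G] [Fintype G] [Group G]

section Action

variable {M : Type*} [AddCommGroup M] [Module k M] [RightComodule k (FunHopf k G) M]

/-- The element `^g u` of a `k^G`-comodule, determined by `Δ u = ∑_g ^g u ⊗ δ_g`. -/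
def gAct (g : G) : M →ₗ[k] M := FunHopf.coord g ∘ₗ RightComodule.coact

theorem coact_eq_sum_gAct (u : M) : (RightComodule.coact u : M ⊗[k] FunHopf k G) =
    ∑ g : G, gAct k g u ⊗ₜ[k] FunHopf.delta k g :=
  FunHopf.tensor_expand _

theorem gAct_one (u : M) : gAct k (1 : G) u = u :=
  LinearMap.congr_fun (RightComodule.coact_counit (k := k) (H := FunHopf k G) (M := M)) u

theorem gAct_mul (g h : G) (u : M) : gAct k (g * h) u = gAct k g (gAct k h u) := by
  have key := LinearMap.congr_fun
    (RightComodule.coact_coassoc (k := k) (H := FunHopf k G) (M := M)) u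
  simp only [LinearMap.comp_apply, LinearEquiv.coe_coe] at key
  rw [← LinearEquiv.eq_symm_apply] at key
  have key' := congrArg (fun z => FunHopf.coord g (FunHopf.coord h z)) key
  simp only [FunHopf.coord_rTensor] at key'
  refine Eq.trans ?_ key'.symm
  change FunHopf.coord (g * h) (RightComodule.coact u : M ⊗[k] FunHopf k G) = _
  generalize (RightComodule.coact u : M ⊗[k] FunHopf k G) = z
  induction z with
  | zero => simp
  | add x y hx hy => simp only [map_add, hx, hy]
  | tmul m f =>
    rw [LinearMap.lTensor_tmul, FunHopf.coord_tmul, ← FunHopf.ev₂_comulMap]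
    change FunHopf.ev₂ g h (FunHopf.comulMap k G f) • m = FunHopf.coord g (FunHopf.coord h
      ((TensorProduct.assoc k _ _ _).symm (m ⊗ₜ[k] (FunHopf.comulMap k G f))))
    generalize FunHopf.comulMap k G f = y
    induction y with
    | zero => simp
    | add x y hx hy => simp only [TensorProduct.tmul_add, map_add, add_smul, hx, hy]
    | tmul a b => simp [mul_comm, smul_smul]

end Action

variable {E : Type w} [Ring E] [Algebra k E] [ComoduleAlgebra k (FunHopf k G) E]

theorem gAct_algebra_one (g : G) : gAct k g (1 : E) = 1 := by
  simp [gAct, ComoduleAlgebra.coact_one, Algebra.TensorProduct.one_def]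

theorem gAct_algebra_mul (g : G) (x y : E) :
    gAct k g (x * y) = gAct k g x * gAct k g y := by
  simp only [gAct, LinearMap.comp_apply, ComoduleAlgebra.coact_mul]
  generalize (RightComodule.coact x : E ⊗[k] FunHopf k G) = X
  generalize (RightComodule.coact y : E ⊗[k] FunHopf k G) = Y
  induction X with
  | zero => simp
  | add X X' h h' => simp only [add_mul, map_add, h, h']
  | tmul e a =>
    induction Y with
    | zero => simp
    | add Y Y' h h' => simp only [mul_add, map_add, h, h']
    | tmul e' a' =>
      simp only [Algebra.TensorProduct.tmul_mul_tmul, FunHopf.coord_tmul, map_mul,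
        smul_mul_smul_comm]

theorem gAct_smul {T : Type*} [AddCommGroup T] [Module k T] [Module Eᵐᵒᵖ T]
    [IsScalarTower k Eᵐᵒᵖ T] [HopfModule k (FunHopf k G) E T] (g : G) (u : T) (x : E) :
    gAct k g (op x • u) = op (gAct k g x) • gAct k g u := by
  simp only [gAct, LinearMap.comp_apply, HopfModule.coact_smul]
  generalize (RightComodule.coact u : T ⊗[k] FunHopf k G) = U
  generalize (RightComodule.coact x : E ⊗[k] FunHopf k G) = X
  induction U with
  | zero => simp
  | add X X' h h' => simp only [smul_add, map_add, LinearMap.add_apply, h, h']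
  | tmul t a =>
    induction X with
    | zero => simp
    | add Y Y' h h' => simp only [MulOpposite.op_add, add_smul, map_add, h, h']
    | tmul e b =>
      change FunHopf.coord g ((op e • t) ⊗ₜ[k] (a * b)) = _
      simp only [FunHopf.coord_tmul, map_mul, MulOpposite.op_smul, smul_assoc, mul_smul]
      rw [smul_comm (op e), smul_comm]

/-- The group `E^×` of the invertible elements of a `k^G`-comodule algebra `E`. The parameters `k`
and `G` only record which coaction defines the `G`-group structure. -/
def UnitGroup (_k _G : Type*) (E : Type w) [Ring E] : Type w := Eˣ

instance UnitGroup.instGroup : Group (UnitGroup k G E) := inferInstanceAs (Group Eˣ)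

/-- The `G`-group structure of `E^×`: `g` sends `x` to `^g x`. -/
instance UnitGroup.instAction : MulDistribMulAction G (UnitGroup k G E) where
  smul g x := (show Eˣ from
    { val := gAct k g (show Eˣ from x).val
      inv := gAct k g (show Eˣ from x).inv
      val_inv := by rw [← gAct_algebra_mul, Units.val_inv, gAct_algebra_one]
      inv_val := by rw [← gAct_algebra_mul, Units.inv_val, gAct_algebra_one] })
  one_smul x := Units.ext (gAct_one k _)
  mul_smul g h x := Units.ext (gAct_mul k g h _)
  smul_mul g x y := Units.ext (gAct_algebra_mul k g _ _)
  smul_one g := Units.ext (gAct_algebra_one k g)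

variable {T : Type*} [AddCommGroup T] [Module Eᵐᵒᵖ T]

theorem op_units_smul_mem (a : Eˣ) {u : T} (hu : u ∈ invElems E T) :
    op (a : E) • u ∈ invElems E T := by
  have h : (fun x : E => op x • (op (a : E) • u)) = (fun x : E => op x • u) ∘ fun x => a * x := by
    funext x
    simp [smul_smul]
  change Function.Bijective _
  rw [h]
  exact Function.Bijective.comp hu (Units.mulLeft a).bijective

theorem bijective_units_smul {u : T} (hu : u ∈ invElems E T) : Function.Bijective fun a : Eˣ =>
    (⟨op (a : E) • u, op_units_smul_mem a hu⟩ : invElems E T) := by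
  constructor
  · intro a b hab
    exact Units.ext (hu.1 (Subtype.ext_iff.1 hab))
  · rintro ⟨v, hv⟩
    obtain ⟨x, hx⟩ := hu.2 v
    obtain ⟨y, hy⟩ := hv.2 u
    dsimp only at hx hy
    refine ⟨⟨x, y, hu.1 ?_, hv.1 ?_⟩, Subtype.ext hx⟩
    · simp [← smul_smul, hx, hy]
    · simp [← smul_smul, hx, hy]

variable [Module k T] [IsScalarTower k Eᵐᵒᵖ T] [HopfModule k (FunHopf k G) E T]

theorem gAct_inv_cancel {M : Type*} [AddCommGroup M] [Module k M]
    [RightComodule k (FunHopf k G) M] (g : G) (m : M) : gAct k g (gAct k g⁻¹ m) = m := by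
  rw [← gAct_mul, mul_inv_cancel, gAct_one]

theorem bijective_gAct {M : Type*} [AddCommGroup M] [Module k M]
    [RightComodule k (FunHopf k G) M] (g : G) : Function.Bijective (gAct k g : M →ₗ[k] M) :=
  Function.bijective_iff_has_inverse.2 ⟨gAct k g⁻¹,
    fun m => by simpa using gAct_inv_cancel k g⁻¹ m, gAct_inv_cancel k g⟩

theorem gAct_mem (g : G) {u : T} (hu : u ∈ invElems E T) : gAct k g u ∈ invElems E T := by
  have h : (fun x : E => op x • gAct k g u) =
      gAct k g ∘ (fun x : E => op x • u) ∘ gAct k g⁻¹ := by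
    funext x
    simp only [Function.comp_apply]
    rw [gAct_smul, gAct_inv_cancel]
  change Function.Bijective _
  rw [h]
  exact (bijective_gAct k g).comp (Function.Bijective.comp hu (bijective_gAct k g⁻¹))

variable {k} in
/-- The `(G, E^×)`-group torsor `T^×` of a `(k^G, E)`-Hopf torsor `T`: the group `G` acts by
`u ↦ ^g u`, and `E^×` acts by `u ↦ u a`. -/
def HopfTorsor.unitsTorsor (T : HopfTorsor k (FunHopf k G) E) :
    GroupTorsor G (UnitGroup k G E) where
  carrier := invElems E T.carrier
  leftAction :=
    { smul := fun g u => ⟨gAct k g u.1, gAct_mem k g u.2⟩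
      one_smul := fun u => Subtype.ext (gAct_one k u.1)
      mul_smul := fun g h u => Subtype.ext (gAct_mul k g h u.1) }
  rightAction :=
    { smul := fun a u => ⟨op (show Eˣ from a.unop).val • u.1, op_units_smul_mem _ u.2⟩
      one_smul := fun u => Subtype.ext (one_smul Eᵐᵒᵖ u.1)
      mul_smul := fun a b u => Subtype.ext
        (mul_smul (op (show Eˣ from a.unop).val) (op (show Eˣ from b.unop).val) u.1) }
  nonempty := T.nonempty_bullet.elim fun u hu => ⟨⟨u, hu.1⟩⟩
  smul_op_smul g a u := Subtype.ext (gAct_smul k g u.1 (show Eˣ from a).val)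
  bijective_op_smul u := bijective_units_smul u.2

variable {k} in
/-- The map `c`, which sends a `(k^G, E)`-Hopf torsor `T` to the class `[T^×]`. -/
def HopfTorsor.unitsClass (T : HopfTorsor k (FunHopf k G) E) :
    GroupTorsorClasses G (UnitGroup k G E) :=
  Quotient.mk _ T.unitsTorsor

end Comparison

/-! As `G` is finite, `k^G` is free on the `δ_g`, so `T ⊗ k^G` is a product of copies of `T` indexed
by `G`. A coaction of `k^G` is then the same as a `k`-linear action of `G`, and Hopf modules become
`E`-modules with a compatible action of `G`. The condition on `Δ_T u` is automatic for `u` in `T^×`: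
its coordinates `^g u` lie in `T^×` again (`mem_bulletElems_of_mem_invElems`).

Both kinds of torsors are governed by `1`-cocycles. A base point `u` gives elements `a_g` of `E^×`
with `^g u = u a_g`, and `^g(u x) = u a_g (^g x)` shows that `a` determines the whole action of `G`,
on `T` as well as on `T^×`.

Injectivity: an isomorphism `φ : T^× → T'^×` gives `u` and `φ u` the same cocycle, so `u x ↦ (φ u)
x` is an isomorphism of Hopf modules (`equiv_of_unitsTorsor_equiv`). Surjectivity: the cocycle `a`
of a group torsor is realised by `E` with the action `x ↦ a_g (^g x)` (`twist`), where the base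
point `1` has cocycle `a`. -/

namespace FunHopf

/-! ### Coactions of `k^G` as actions of `G`, in coordinates -/

variable {k : Type*} [CommRing k] {G : Type*} [DecidableEq G] [Fintype G]

/-- Since `(ev g ⊗ ev h) ∘ Δ = ev (g * h)`, coassociativity of a coaction amounts in coordinates to
multiplicativity of the action. -/
theorem coord_coord_assoc_symm_lTensor_comul [Group G] {M : Type*} [AddCommGroup M] [Module k M]
    (g h : G) (z : M ⊗[k] FunHopf k G) :
    coord g (coord h ((TensorProduct.assoc k _ _ _).symm
      (LinearMap.lTensor M (Coalgebra.comul (R := k) (A := FunHopf k G)) z))) =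
      coord (g * h) z := by
  induction z with
  | zero => simp
  | add x y hx hy => simp only [map_add, hx, hy]
  | tmul m f =>
    rw [LinearMap.lTensor_tmul, coord_tmul, ← ev₂_comulMap]
    change coord g (coord h ((TensorProduct.assoc k _ _ _).symm (m ⊗ₜ[k] (comulMap k G f)))) =
      ev₂ g h (comulMap k G f) • m
    -- Both sides are linear in the tensor, so pure tensors may stand in for `Δ f`.
    generalize comulMap k G f = y
    induction y with
    | zero => simp
    | add x y hx hy => simp only [TensorProduct.tmul_add, map_add, add_smul, hx, hy]
    | tmul a b => simp [mul_comm, smul_smul]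

/-- The element of `M ⊗ k^G` with given coordinates. -/
def ofCoords {M : Type*} [AddCommGroup M] [Module k M] (m : G → M) : M ⊗[k] FunHopf k G :=
  ∑ g, m g ⊗ₜ[k] delta k g

@[simp] theorem coord_ofCoords {M : Type*} [AddCommGroup M] [Module k M] (m : G → M) (g : G) :
    coord g (ofCoords m : M ⊗[k] FunHopf k G) = m g := by
  simp [ofCoords, map_sum]

/-- The `k^G`-comodule structure defined by a `k`-linear action of `G`. -/
abbrev comoduleOfAction [Group G] {M : Type*} [AddCommGroup M] [Module k M] (ρ : G → M →ₗ[k] M)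
    (hρ_one : ∀ m, ρ 1 m = m) (hρ_mul : ∀ g h m, ρ (g * h) m = ρ g (ρ h m)) :
    RightComodule k (FunHopf k G) M where
  coact :=
    { toFun := fun m => ofCoords fun g => ρ g m
      map_add' := fun m n => tensor_ext fun g => by simp
      map_smul' := fun c m => tensor_ext fun g => by simp }
  coact_coassoc := by
    refine LinearMap.ext fun m => ?_
    simp only [LinearMap.comp_apply, LinearEquiv.coe_coe]
    rw [← LinearEquiv.eq_symm_apply]
    refine tensor_ext fun h => tensor_ext fun g => ?_
    rw [coord_rTensor, coord_coord_assoc_symm_lTensor_comul]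
    simp [hρ_mul]
  coact_counit := by
    refine LinearMap.ext fun m => ?_
    change coord 1 (ofCoords fun g => ρ g m : M ⊗[k] FunHopf k G) = m
    simp [hρ_one]

section RightModules

variable {E T : Type*} [Ring E] [Algebra k E] [AddCommGroup T] [Module k T] [Module Eᵐᵒᵖ T]
  [IsScalarTower k Eᵐᵒᵖ T] [Group G]

/-- As `ev g` is multiplicative, `E ⊗ k^G` acts on `T ⊗ k^G` one coordinate at a time. -/
theorem coord_tensorRightAct (g : G) (z : T ⊗[k] FunHopf k G) (X : E ⊗[k] FunHopf k G) :
    coord g (tensorRightAct k (FunHopf k G) E T z X) = op (coord g X) • coord g z := by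
  induction z with
  | zero => simp
  | add X X' h h' => simp only [smul_add, map_add, LinearMap.add_apply, h, h']
  | tmul t a =>
    induction X with
    | zero => simp
    | add Y Y' h h' => simp only [MulOpposite.op_add, add_smul, map_add, h, h']
    | tmul e b =>
      change coord g ((op e • t) ⊗ₜ[k] (a * b)) = _
      simp only [coord_tmul, map_mul, MulOpposite.op_smul, smul_assoc, mul_smul]
      rw [smul_comm (op e), smul_comm]

/-- In coordinates, the action map of `z` is the product over `g` of the maps `x ↦ z_g x`, and a
product of bijections is bijective. -/
theorem mem_tensorInvElems_of_coord_mem {z : T ⊗[k] FunHopf k G}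
    (hz : ∀ g, coord g z ∈ invElems E T) : z ∈ tensorInvElems k (FunHopf k G) E T := by
  constructor
  · intro X Y hXY
    refine tensor_ext fun g => (hz g).1 ?_
    simpa only [coord_tensorRightAct] using congrArg (coord g) hXY
  · intro y
    choose x hx using fun g => (hz g).2 (coord g y)
    refine ⟨ofCoords x, tensor_ext fun g => ?_⟩
    rw [coord_tensorRightAct, coord_ofCoords]
    exact hx g

end RightModules

end FunHopf

/-! ### Group torsors and their cocycles -/

/-- The isomorphism is `p b ↦ q b`. It is `G`-equivariant because `^g(p b) = p a_g (^g b)` and the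
same formula holds for `q`. -/
theorem GroupTorsor.equiv_of_smul_eq {G : Type*} [Group G] {A : Type w} [Group A]
    [MulDistribMulAction G A] {P Q : GroupTorsor G A} (p : P.carrier) (q : Q.carrier) (a : G → A)
    (hp : ∀ g, g • p = op (a g) • p) (hq : ∀ g, g • q = op (a g) • q) : P ≈ Q := by
  let eP : A ≃ P.carrier := Equiv.ofBijective _ (P.bijective_op_smul p)
  let eQ : A ≃ Q.carrier := Equiv.ofBijective _ (Q.bijective_op_smul q)
  have key : ∀ b : A, (eP.symm.trans eQ) (op b • p) = op b • q := fun b =>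
    congrArg eQ (eP.symm_apply_apply b)
  refine ⟨eP.symm.trans eQ, fun g x => ?_, fun b x => ?_⟩
  · obtain ⟨c, rfl⟩ := (P.bijective_op_smul p).2 x
    dsimp only
    rw [P.smul_op_smul, hp, smul_smul, ← MulOpposite.op_mul, key, key, Q.smul_op_smul, hq,
      smul_smul, ← MulOpposite.op_mul]
  · obtain ⟨c, rfl⟩ := (P.bijective_op_smul p).2 x
    dsimp only
    rw [smul_smul, ← MulOpposite.op_mul, key, key, smul_smul, ← MulOpposite.op_mul]

/-- Simple transitivity defines `a_g`. The cocycle identity follows by cancelling `p` in `p a_{gh} =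
^g(p a_h) = p a_g (^g a_h)`. -/
theorem GroupTorsor.exists_smul_eq {G : Type*} [Group G] {A : Type w} [Group A]
    [MulDistribMulAction G A] (P : GroupTorsor G A) (p : P.carrier) :
    ∃ a : G → A, (∀ g, g • p = op (a g) • p) ∧ a 1 = 1 ∧
      ∀ g h, a (g * h) = a g * g • a h := by
  choose a ha using fun g : G => (P.bijective_op_smul p).2 (g • p)
  dsimp only at ha
  refine ⟨a, fun g => (ha g).symm, (P.bijective_op_smul p).1 ?_, fun g h =>
    (P.bijective_op_smul p).1 ?_⟩
  · dsimp only
    rw [ha, one_smul, MulOpposite.op_one, one_smul]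
  · dsimp only
    rw [ha, mul_smul, ← ha h, P.smul_op_smul, ← ha g, smul_smul, ← MulOpposite.op_mul]

/-- The `E`-linear bijection `E → T`, `x ↦ u x`, for `u` in `T^×`. -/
noncomputable def invElemsEquiv {E T : Type*} [Ring E] [AddCommGroup T] [Module Eᵐᵒᵖ T] {u : T}
    (hu : u ∈ invElems E T) : E ≃ₗ[Eᵐᵒᵖ] T :=
  LinearEquiv.ofBijective
    { toFun := fun x => op x • u
      map_add' := fun x y => by rw [MulOpposite.op_add, add_smul]
      map_smul' := fun a x => by
        change op (x * a.unop) • u = a • op x • u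
        rw [MulOpposite.op_mul, MulOpposite.op_unop, mul_smul] } hu

@[simp] theorem invElemsEquiv_apply {E T : Type*} [Ring E] [AddCommGroup T] [Module Eᵐᵒᵖ T] {u : T}
    (hu : u ∈ invElems E T) (x : E) : invElemsEquiv hu x = op x • u := rfl

theorem map_mem_invElems {E T T' : Type*} [Ring E] [AddCommGroup T] [Module Eᵐᵒᵖ T]
    [AddCommGroup T'] [Module Eᵐᵒᵖ T'] (f : T ≃ₗ[Eᵐᵒᵖ] T') {u : T} (hu : u ∈ invElems E T) :
    f u ∈ invElems E T' := by
  have h : (fun x : E => op x • f u) = f ∘ fun x : E => op x • u := by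
    funext x
    simp
  change Function.Bijective _
  rw [h]
  exact f.bijective.comp hu

/-! ### Comparison of Hopf torsors with group torsors -/

section Comparison

variable {k : Type*} [CommRing k] {G : Type*} [DecidableEq G] [Fintype G] [Group G]
  {E : Type w} [Ring E] [Algebra k E] [ComoduleAlgebra k (FunHopf k G) E]

theorem mem_bulletElems_of_mem_invElems {T : Type*} [AddCommGroup T] [Module k T] [Module Eᵐᵒᵖ T]
    [IsScalarTower k Eᵐᵒᵖ T] [HopfModule k (FunHopf k G) E T] {u : T} (hu : u ∈ invElems E T) :
    u ∈ bulletElems k (FunHopf k G) E T :=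
  ⟨hu, FunHopf.mem_tensorInvElems_of_coord_mem fun g => gAct_mem k g hu⟩

namespace HopfTorsor

theorem isHopfIso_iff (T T' : HopfTorsor k (FunHopf k G) E)
    (f : T.carrier ≃ₗ[Eᵐᵒᵖ] T'.carrier) :
    IsHopfIso T T' f ↔ ∀ (g : G) (u : T.carrier), f (gAct k g u) = gAct k g (f u) := by
  constructor
  · intro h g u
    have := congrArg (FunHopf.coord g) (h u)
    rwa [FunHopf.coord_rTensor] at this
  · intro h u
    refine FunHopf.tensor_ext fun g => ?_
    rw [FunHopf.coord_rTensor]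
    exact h g u

theorem unitsTorsor_equiv {T T' : HopfTorsor k (FunHopf k G) E} (h : T ≈ T') :
    T.unitsTorsor ≈ T'.unitsTorsor := by
  obtain ⟨f, hf⟩ := h
  rw [isHopfIso_iff] at hf
  refine ⟨⟨fun u => ⟨f u.1, map_mem_invElems f u.2⟩,
    fun u => ⟨f.symm u.1, map_mem_invElems f.symm u.2⟩,
    fun u => Subtype.ext (f.symm_apply_apply _), fun u => Subtype.ext (f.apply_symm_apply _)⟩,
    fun g u => Subtype.ext (hf g u.1), fun a u => Subtype.ext (f.map_smul _ _)⟩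

theorem equiv_of_unitsTorsor_equiv {T T' : HopfTorsor k (FunHopf k G) E}
    (h : T.unitsTorsor ≈ T'.unitsTorsor) : T ≈ T' := by
  obtain ⟨φ, hφG, hφA⟩ := h
  obtain ⟨u⟩ := T.unitsTorsor.nonempty
  obtain ⟨a, ha, -⟩ := T.unitsTorsor.exists_smul_eq u
  have hu (g : G) : gAct k g u.1 = op (show Eˣ from a g).val • u.1 := congrArg Subtype.val (ha g)
  have hφu (g : G) : gAct k g (φ u).1 = op (show Eˣ from a g).val • (φ u).1 :=
    congrArg Subtype.val (((hφG g u).symm.trans (congrArg φ (ha g))).trans (hφA (a g) u))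
  -- This is the map `u x ↦ (φ u) x`.
  let f := (invElemsEquiv u.2).symm.trans (invElemsEquiv (φ u).2)
  have hf (x : E) : f (op x • u.1) = op x • (φ u).1 :=
    congrArg (invElemsEquiv (φ u).2) ((invElemsEquiv u.2).symm_apply_apply x)
  refine ⟨f, (isHopfIso_iff T T' f).2 fun g t => ?_⟩
  obtain ⟨x, rfl⟩ := (invElemsEquiv u.2).surjective t
  -- Both sides become `(φ u) a_g (^g x)`.
  rw [invElemsEquiv_apply, gAct_smul, hu, smul_smul, ← MulOpposite.op_mul, hf, hf, gAct_smul, hφu,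
    smul_smul, ← MulOpposite.op_mul]

theorem one_mem_invElems : (1 : E) ∈ invElems E E := by
  change Function.Bijective fun x : E => 1 * x
  simp only [one_mul]
  exact Function.bijective_id

/-- The Hopf module `E` with coaction twisted by the `1`-cocycle `a`: the group `G` acts by
`x ↦ a_g (^g x)`. -/
abbrev twistHopfModule (a : G → UnitGroup k G E) (ha_one : a 1 = 1)
    (ha_mul : ∀ g h, a (g * h) = a g * g • a h) : HopfModule k (FunHopf k G) E E where
  toRightComodule := FunHopf.comoduleOfAction
    (fun g => LinearMap.mulLeft k (show Eˣ from a g).val ∘ₗ gAct k g)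
    (fun x => by
      change (show Eˣ from a 1).val * gAct k (1 : G) x = x
      rw [ha_one, gAct_one]
      exact one_mul x)
    (fun g h x => by
      change (show Eˣ from a (g * h)).val * gAct k (g * h) x =
        (show Eˣ from a g).val * gAct k g ((show Eˣ from a h).val * gAct k h x)
      -- By the cocycle identity, both sides are `a_g (^g a_h) (^{gh} x)`.
      rw [ha_mul, gAct_mul, gAct_algebra_mul, ← mul_assoc]
      rfl)
  coact_smul u x := FunHopf.tensor_ext fun g => by
    rw [FunHopf.coord_tensorRightAct]
    refine (FunHopf.coord_ofCoords _ g).trans (Eq.trans ?_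
      (congrArg (op (gAct k g x) • ·) (FunHopf.coord_ofCoords _ g).symm))
    change (show Eˣ from a g).val * gAct k g (u * x) =
      (show Eˣ from a g).val * gAct k g u * gAct k g x
    rw [gAct_algebra_mul, mul_assoc]

/-- The Hopf torsor obtained by twisting `(E, Δ_E)` by a `1`-cocycle. -/
def twist (a : G → UnitGroup k G E) (ha_one : a 1 = 1)
    (ha_mul : ∀ g h, a (g * h) = a g * g • a h) : HopfTorsor k (FunHopf k G) E :=
  { carrier := E
    hopfModule := twistHopfModule a ha_one ha_mul
    nonempty_bullet :=
      -- The Hopf module structure is passed explicitly, since `E` also carries the untwisted one as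
      -- an instance.
      ⟨1, @mem_bulletElems_of_mem_invElems _ _ _ _ _ _ _ _ _ _ _ _ _ _ _
        (twistHopfModule a ha_one ha_mul) _ one_mem_invElems⟩ }

/-- In the twisted module `^g 1 = a_g = 1 a_g`, so the base points `1` and `p` have the same
cocycle. -/
theorem unitsTorsor_twist_equiv (P : GroupTorsor G (UnitGroup k G E)) (p : P.carrier)
    (a : G → UnitGroup k G E) (hp : ∀ g, g • p = op (a g) • p) (ha_one : a 1 = 1)
    (ha_mul : ∀ g h, a (g * h) = a g * g • a h) :
    (twist a ha_one ha_mul).unitsTorsor ≈ P := by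
  refine GroupTorsor.equiv_of_smul_eq (P := (twist a ha_one ha_mul).unitsTorsor)
    ⟨(1 : E), one_mem_invElems (E := E)⟩ p a (fun g => Subtype.ext ?_) hp
  refine (FunHopf.coord_ofCoords _ g).trans ?_
  change (show Eˣ from a g).val * gAct k g (1 : E) = 1 * (show Eˣ from a g).val
  rw [gAct_algebra_one, mul_one, one_mul]

/-- On both sides the base point `1` is fixed by `G`, so both have the trivial cocycle. -/
theorem unitsTorsor_self_equiv :
    (self k (FunHopf k G) E).unitsTorsor ≈ GroupTorsor.self G (UnitGroup k G E) := by
  refine GroupTorsor.equiv_of_smul_eq (P := (self k (FunHopf k G) E).unitsTorsor)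
    (Q := GroupTorsor.self G (UnitGroup k G E))
    ⟨(1 : E), one_mem_invElems (E := E)⟩ (1 : UnitGroup k G E) (fun _ => 1) (fun g => Subtype.ext ?_)
    (fun g => ?_)
  · change gAct k g (1 : E) = 1 * 1
    rw [gAct_algebra_one, one_mul]
  · change g • (1 : UnitGroup k G E) = 1 * 1
    rw [smul_one, one_mul]

end HopfTorsor

end Comparison

theorem corollary3p8 {k : Type u} [CommRing k] {G : Type v} [Group G] [Fintype G] [DecidableEq G]
    {E : Type w} [Ring E] [Algebra k E] [ComoduleAlgebra k (FunHopf k G) E] :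
    ∃ c : HopfTorsorClasses k (FunHopf k G) E → GroupTorsorClasses G (UnitGroup k G E),
      (∀ T : HopfTorsor k (FunHopf k G) E, c (Quotient.mk _ T) = T.unitsClass) ∧
      Function.Bijective c ∧
      c (Quotient.mk _ (HopfTorsor.self k (FunHopf k G) E)) =
        Quotient.mk _ (GroupTorsor.self G (UnitGroup k G E)) := by
  refine ⟨Quotient.lift HopfTorsor.unitsClass fun T T' h =>
    Quotient.sound (HopfTorsor.unitsTorsor_equiv h), fun T => rfl, ⟨?_, ?_⟩,
    Quotient.sound HopfTorsor.unitsTorsor_self_equiv⟩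
  · rintro ⟨T⟩ ⟨T'⟩ h
    exact Quotient.sound (HopfTorsor.equiv_of_unitsTorsor_equiv (Quotient.exact h))
  · rintro ⟨P⟩
    obtain ⟨p⟩ := P.nonempty
    obtain ⟨a, hp, ha_one, ha_mul⟩ := P.exists_smul_eq p
    exact ⟨Quotient.mk _ (HopfTorsor.twist a ha_one ha_mul),
      Quotient.sound (HopfTorsor.unitsTorsor_twist_equiv P p a hp ha_one ha_mul)⟩
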